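/- Let $k,i,n,m$ be integers with $1\le i\le k$ and $n,m\ge 0$. *Paths.* A lattice path starts at a point $(0,a)$ with $a\ge 0$ an integer, ends on the $x$-axis, and consists of finitely many moves, each either $\alpha:(x,y)\to(x+1,\max(0,y-1))$ or $\beta:(x,y)\to(x+1,y+1)$; its last move (if any) is not a horizontal move along the $x$-axis. A peak is a point of the path that is reached by a move $\beta$ and left by a move $\alpha$. The weight of a path is the sum of the $x$-coordinates of its peaks. The charge of a peak $(x,y)$ is the largest integer $c$ for which there are two points $(x',y-c)$ and $(x'',y-c)$ on the path with $x'<x<x''$ such that between these two points there is no peak of height larger than $y$ and every other peak of height $y$ has $x$-coordinate larger than $x$. The total charge of a path is the sum of the charges of its peaks. Let $P_{k,i}(n,m)$ be the number of lattice paths of weight $n$ and total charge $m$ that start at $(0,k-i)$ and all of whose peaks have height at most $k-1$. *Multiple partitions.* Let $G_{k,i}(n,m)$ be the number of tuples $(n^{(1)},\dots,n^{(k-1)})$ of finite (possibly empty) sequences of positive integers $n^{(j)}=(n^{(j)}_1,\dots,n^{(j)}_{m_j})$ such that, for all $1\le j\le k-1$, $$n^{(j)}_\ell\ \ge\ n^{(j)}_{\ell+1}+2j\quad(1\le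 \ell<m_j),\qquad n^{(j)}_{m_j}\ \ge\ j+\max(j-i+1,0)+2j\,(m_{j+1}+\cdots+m_{k-1})\quad\text{if } m_j\ge 1,$$ and $$\sum_{j=1}^{k-1}\sum_{\ell=1}^{m_j} n^{(j)}_\ell=n,\qquad \sum_{j=1}^{k-1} j\,m_j=m .$$ Then both numbers are finite and $$P_{k,i}(n,m)=G_{k,i}(n,m).$$ -/

import Mathlib

/-- The two moves of a lattice path: `alpha` goes from `(x, y)` to `(x + 1, max (0, y - 1))`,
`beta` goes from `(x, y)` to `(x + 1, y + 1)`. -/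
inductive Step : Type
  | alpha : Step
  | beta : Step
deriving DecidableEq

/-- The effect of a move on the height. Subtraction on `ℕ` is truncated, so that
`y - 1` is `max (0, y - 1)`. -/
def Step.move : Step → ℕ → ℕ
  | Step.alpha, y => y - 1
  | Step.beta, y => y + 1

/-- The height at abscissa `x` of the path that starts at `(0, a)` and follows the word `w`;
it is meaningful for `x ≤ w.length`. -/
def pathHeight (a : ℕ) (w : List Step) (x : ℕ) : ℕ :=
  (w.take x).foldl (fun y s => s.move y) a

/-- The point at abscissa `x` is a peak: it is reached by a `beta` and left by an `alpha`. -/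
def IsPeak (w : List Step) (x : ℕ) : Prop :=
  0 < x ∧ w[x - 1]? = some Step.beta ∧ w[x]? = some Step.alpha

instance (w : List Step) : DecidablePred (IsPeak w) := fun x => by
  unfold IsPeak
  infer_instance

/-- The abscissas of the peaks. -/
def peaks (w : List Step) : Finset ℕ :=
  (Finset.range w.length).filter (IsPeak w)

/-- `c` is admissible for the peak at abscissa `x`, of height `y`: there are points `(x', y - c)` and
`(x'', y - c)` on the path, with `x' < x < x''`, such that between them there is no peak
of height larger than `y`, and the other peaks of height `y` lie to the right of `x`. -/
def ChargeAdmissible (a : ℕ) (w : List Step) (x c : ℕ) : Prop :=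
  ∃ x' x'' : ℕ, x' < x ∧ x < x'' ∧ x'' ≤ w.length ∧
    pathHeight a w x' + c = pathHeight a w x ∧
    pathHeight a w x'' + c = pathHeight a w x ∧
    ∀ z ∈ peaks w, x' < z → z < x'' → z ≠ x →
      pathHeight a w z ≤ pathHeight a w x ∧
        (pathHeight a w z = pathHeight a w x → x < z)

/-- The charge of the peak at abscissa `x`: the largest admissible `c`. (For a peak, `c = 1` is
admissible, and every admissible `c` is at most the height of the peak.) -/
noncomputable def charge (a : ℕ) (w : List Step) (x : ℕ) : ℕ :=
  sSup {c : ℕ | ChargeAdmissible a w x c}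

/-- The weight of a path: the sum of the abscissas of its peaks. -/
def pathWeight (w : List Step) : ℕ :=
  ∑ x ∈ peaks w, x

/-- The total charge of a path. -/
noncomputable def totalCharge (a : ℕ) (w : List Step) : ℕ :=
  ∑ x ∈ peaks w, charge a w x

/-- The word `w` describes a lattice path from `(0, a)` to the horizontal axis, all of whose peaks
have height at most `h`. The last move, if there is one, is not a horizontal move along the axis:
otherwise a path could be prolonged by any number of such moves. -/
structure IsRestrictedPath (a h : ℕ) (w : List Step) : Prop where
  ends_on_axis : pathHeight a w w.length = 0
  last_not_horizontal : ∀ t, t + 1 = w.length → pathHeight a w t ≠ 0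
  peak_le : ∀ x ∈ peaks w, pathHeight a w x ≤ h

/-- The restricted lattice paths counted by `P_{k,i}(n,m)`. -/
def restrictedPaths (k i n m : ℕ) : Set (List Step) :=
  {w | IsRestrictedPath (k - i) (k - 1) w ∧ pathWeight w = n ∧ totalCharge (k - i) w = m}

/-- The number `P_{k,i}(n,m)`. -/
noncomputable def numPaths (k i n m : ℕ) : ℕ :=
  (restrictedPaths k i n m).ncard

/-- The conditions on a multiple partition `(n^(1), …, n^(k-1))`. The partition `n^(j)` is
`p ⟨j - 1, _⟩`, listed from its largest part `n^(j)_1` to its smallest part. -/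
structure IsMultiplePartition (k i : ℕ) (p : Fin (k - 1) → List ℕ) : Prop where
  /-- `n^(j)_l ≥ n^(j)_{l+1} + 2 j`. -/
  gap : ∀ j : Fin (k - 1), (p j).IsChain (fun x y => x ≥ y + 2 * (j.val + 1))
  /-- The smallest part of `n^(j)`, if there is one, is at least
  `j + max (j - i + 1, 0) + 2 j (m_{j+1} + ⋯ + m_{k-1})`. -/
  smallest : ∀ j : Fin (k - 1), ∀ x ∈ (p j).getLast?,
    (x : ℤ) ≥ ((j.val + 1 : ℕ) : ℤ) + max (((j.val + 1 : ℕ) : ℤ) - (i : ℤ) + 1) 0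
      + 2 * ((j.val + 1 : ℕ) : ℤ) * ((∑ l ∈ Finset.Ioi j, (p l).length : ℕ) : ℤ)

/-- The multiple partitions counted by `G_{k,i}(n,m)`: the sum of all parts is `n`, and
`∑ j, j * m_j = m`. -/
def multiplePartitions (k i n m : ℕ) : Set (Fin (k - 1) → List ℕ) :=
  {p | IsMultiplePartition k i p ∧ ∑ j, (p j).sum = n ∧
    ∑ j, (j.val + 1) * (p j).length = m}

/-- The number `G_{k,i}(n,m)`. -/
noncomputable def numMultiplePartitions (k i n m : ℕ) : ℕ :=
  (multiplePartitions k i n m).ncard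

/-! Both sides are put in bijection with tuples of `k - 1` arbitrary multisets of natural numbers.
Continue every path by infinitely many `alpha` moves, so that paths become words without trailing
`alpha`. The operation `shrink` deletes all factors `beta alpha` at once, which lowers every peak by
one, and `bumps` records as a multiset where in the shrunk word the factors stood.

If the word has `N` peaks, then its weight is the sum of the bumps plus `N ^ 2` (`sum_peakSet`) and
its total charge is `N` plus that of the shrunk word (`wordCharge_shrink`). The pair of shrunk word
and bumps determines the word, and the only constraint on it is that every peak of the shrunk word
is a bump (`exists_shrink_eq`, `eq_of_shrink_eq_of_bumps_eq`). Hence the bumps that exceed the peak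
set of the shrunk word form an arbitrary multiset, while the height bound drops by one. When the
path starts at the height bound, its first move must be `alpha`; removing it costs `N` in weight and
nothing in charge. Iterating yields `exists_isEncoding`.

For multiple partitions, subtracting the smallest admissible sequence from each `n^(j)` also leaves
an arbitrary multiset (`toPartition`). The statistics agree because the sum of the squared peak
numbers, `N_1 ^ 2 + N_2 ^ 2 + ⋯` with `N_j = m_j + m_{j+1} + ⋯`, and the initial `alpha` moves
account exactly for the subtracted terms (`tupleWeight_eq`, `sum_toPartition`). -/

namespace LatticePath

open Step

/-! ### Words continued by infinitely many `alpha` moves -/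

/-- The move at abscissa `x` of the word `w` continued by `alpha` moves. -/
def stepAt (w : List Step) (x : ℕ) : Step := w[x]?.getD alpha

/-- The height at abscissa `x` of the word `w` continued by `alpha` moves. -/
def height (a : ℕ) : List Step → ℕ → ℕ
  | [], x => a - x
  | _ :: _, 0 => a
  | s :: r, x + 1 => height (s.move a) r x

/-- The abscissas of the peaks of the word `w` continued by `alpha` moves. -/
def peakSet (w : List Step) : Finset ℕ := peaks (w ++ [alpha])

@[simp] lemma stepAt_nil (x : ℕ) : stepAt [] x = alpha := by simp [stepAt]
@[simp] lemma stepAt_cons_zero (s : Step) (r : List Step) : stepAt (s :: r) 0 = s := by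
  simp [stepAt]
@[simp] lemma stepAt_cons_succ (s : Step) (r : List Step) (x : ℕ) :
    stepAt (s :: r) (x + 1) = stepAt r x := by simp [stepAt]

@[simp] lemma height_zero (a : ℕ) (w : List Step) : height a w 0 = a := by
  cases w <;> simp [height]

@[simp] lemma height_nil (a x : ℕ) : height a [] x = a - x := by simp [height]

@[simp] lemma height_cons_succ (a : ℕ) (s : Step) (r : List Step) (x : ℕ) :
    height a (s :: r) (x + 1) = height (s.move a) r x := rfl

lemma height_succ (a : ℕ) (w : List Step) (x : ℕ) :
    height a w (x + 1) = (stepAt w x).move (height a w x) := by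
  induction w generalizing a x with
  | nil => simp [Step.move]; omega
  | cons s r ih => cases x with
    | zero => simp
    | succ x => simp [ih]

lemma height_succ_of_beta {a : ℕ} {w : List Step} {x : ℕ} (h : stepAt w x = beta) :
    height a w (x + 1) = height a w x + 1 := by rw [height_succ, h]; rfl

lemma height_succ_of_alpha {a : ℕ} {w : List Step} {x : ℕ} (h : stepAt w x = alpha) :
    height a w (x + 1) = height a w x - 1 := by rw [height_succ, h]; rfl

lemma eq_alpha_or_eq_beta (s : Step) : s = alpha ∨ s = beta := by cases s <;> simp

lemma mem_peakSet {w : List Step} {x : ℕ} :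
    x ∈ peakSet w ↔ 0 < x ∧ stepAt w (x - 1) = beta ∧ stepAt w x = alpha := by
  unfold peakSet peaks IsPeak stepAt
  simp only [Finset.mem_filter, Finset.mem_range, List.length_append, List.length_singleton,
    List.getElem?_append]
  constructor
  · rintro ⟨h1, h2, h3, h4⟩
    have : x - 1 < w.length := by omega
    simp only [this, if_true] at h3
    refine ⟨h2, by simp [h3], ?_⟩
    split_ifs at h4 with h5
    · simp [h4]
    · simp [List.getElem?_eq_none (not_lt.1 h5)]
  · rintro ⟨h2, h3, h4⟩
    have h1 : x - 1 < w.length := by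
      by_contra h
      rw [List.getElem?_eq_none (not_lt.1 h)] at h3
      simp at h3
    refine ⟨by omega, h2, ?_, ?_⟩
    · simp only [h1, if_true]
      rw [List.getElem?_eq_getElem h1] at h3 ⊢
      simpa using h3
    · split_ifs with h5
      · rw [List.getElem?_eq_getElem h5] at h4 ⊢
        simpa using h4
      · have : x - w.length = 0 := by omega
        simp [this]

@[simp] lemma succ_mem_peakSet {w : List Step} {x : ℕ} :
    x + 1 ∈ peakSet w ↔ stepAt w x = beta ∧ stepAt w (x + 1) = alpha := by
  simp [mem_peakSet]

@[simp] lemma zero_notMem_peakSet (w : List Step) : 0 ∉ peakSet w := by simp [mem_peakSet]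

lemma height_pos_of_mem_peakSet {a : ℕ} {w : List Step} {x : ℕ} (hx : x ∈ peakSet w) :
    height a w x = height a w (x - 1) + 1 := by
  obtain ⟨h1, h2, -⟩ := mem_peakSet.1 hx
  obtain ⟨x, rfl⟩ := Nat.exists_eq_succ_of_ne_zero h1.ne'
  exact height_succ_of_beta h2

/-- A point above both ends of an interval forces a peak of at least its height in between. -/
lemma exists_peak_between {a : ℕ} {w : List Step} {p u q : ℕ} (hpu : p ≤ u) (huq : u ≤ q)
    (hp : height a w p < height a w u) (hq : height a w q < height a w u) :
    ∃ z ∈ peakSet w, p < z ∧ z < q ∧ height a w u ≤ height a w z := by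
  obtain ⟨z, hz, hmax⟩ := Finset.exists_max_image (Finset.Icc p q) (height a w)
    ⟨u, Finset.mem_Icc.2 ⟨hpu, huq⟩⟩
  rw [Finset.mem_Icc] at hz
  have hu := hmax u (Finset.mem_Icc.2 ⟨hpu, huq⟩)
  have hpz : p < z := lt_of_le_of_ne hz.1 (by rintro rfl; omega)
  have hzq : z < q := lt_of_le_of_ne hz.2 (by rintro rfl; omega)
  refine ⟨z, ?_, hpz, hzq, hu⟩
  obtain ⟨z, rfl⟩ := Nat.exists_eq_succ_of_ne_zero (by omega : z ≠ 0)
  have h1 := hmax z (Finset.mem_Icc.2 ⟨by omega, by omega⟩)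
  have h2 := hmax (z + 1 + 1) (Finset.mem_Icc.2 ⟨by omega, by omega⟩)
  refine succ_mem_peakSet.2 ⟨?_, ?_⟩
  · refine (eq_alpha_or_eq_beta _).resolve_left fun h => ?_
    have := height_succ_of_alpha (a := a) h
    simp only [Nat.succ_eq_add_one] at *
    omega
  · refine (eq_alpha_or_eq_beta _).resolve_right fun h => ?_
    have := height_succ_of_beta (a := a) h
    simp only [Nat.succ_eq_add_one] at *
    omega

lemma height_succ_le (a : ℕ) (w : List Step) (x : ℕ) :
    height a w (x + 1) ≤ height a w x + 1 := by
  rcases eq_alpha_or_eq_beta (stepAt w x) with h | h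
  · rw [height_succ_of_alpha h]; omega
  · rw [height_succ_of_beta h]

lemma le_height_succ (a : ℕ) (w : List Step) (x : ℕ) :
    height a w x ≤ height a w (x + 1) + 1 := by
  rcases eq_alpha_or_eq_beta (stepAt w x) with h | h
  · rw [height_succ_of_alpha h]; omega
  · rw [height_succ_of_beta h]; omega

lemma exists_height_eq_of_le {a : ℕ} {w : List Step} {p q m : ℕ} (hpq : p ≤ q)
    (hp : height a w p ≤ m) (hq : m ≤ height a w q) :
    ∃ r, p ≤ r ∧ r ≤ q ∧ height a w r = m := by
  induction q, hpq using Nat.le_induction with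
  | base => exact ⟨p, le_rfl, le_rfl, le_antisymm hp hq⟩
  | succ q hpq ih =>
    by_cases h : m ≤ height a w q
    · obtain ⟨r, h1, h2, h3⟩ := ih h
      exact ⟨r, h1, by omega, h3⟩
    · have := height_succ_le a w q
      exact ⟨q + 1, by omega, le_rfl, by omega⟩

lemma exists_height_eq_of_ge {a : ℕ} {w : List Step} {p q m : ℕ} (hpq : p ≤ q)
    (hp : m ≤ height a w p) (hq : height a w q ≤ m) :
    ∃ r, p ≤ r ∧ r ≤ q ∧ height a w r = m := by
  induction q, hpq using Nat.le_induction with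
  | base => exact ⟨p, le_rfl, le_rfl, le_antisymm hq hp⟩
  | succ q hpq ih =>
    by_cases h : height a w q ≤ m
    · obtain ⟨r, h1, h2, h3⟩ := ih h
      exact ⟨r, h1, by omega, h3⟩
    · have := le_height_succ a w q
      exact ⟨q + 1, by omega, le_rfl, by omega⟩

/-! ### Charges in terms of infinitely continued words -/

/-- The positive `c` is admissible for the peak at `x`. In contrast to `ChargeAdmissible`, the two
points of the path are only required to have height at most the height of the peak minus `c`. -/
def Admissible (a : ℕ) (w : List Step) (x c : ℕ) : Prop :=
  1 ≤ c ∧ ∃ x' x'' : ℕ, x' < x ∧ x < x'' ∧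
    height a w x' + c ≤ height a w x ∧ height a w x'' + c ≤ height a w x ∧
    ∀ z ∈ peakSet w, x' < z → z < x'' → z ≠ x →
      height a w z ≤ height a w x ∧ (height a w z = height a w x → x < z)

/-- The charge of a peak of a word continued by `alpha` moves. -/
noncomputable def peakCharge (a : ℕ) (w : List Step) (x : ℕ) : ℕ :=
  sSup {c | Admissible a w x c}

lemma admissible_one {a : ℕ} {w : List Step} {x : ℕ} (hx : x ∈ peakSet w) :
    Admissible a w x 1 := by
  have h := height_pos_of_mem_peakSet (a := a) hx
  obtain ⟨h1, -, h3⟩ := mem_peakSet.1 hx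
  have := height_succ_of_alpha (a := a) h3
  exact ⟨le_rfl, x - 1, x + 1, by omega, by omega, by omega, by omega, fun z _ _ _ _ => by omega⟩

lemma Admissible.le_height {a : ℕ} {w : List Step} {x c : ℕ} (h : Admissible a w x c) :
    c ≤ height a w x := by
  obtain ⟨-, x', x'', -, -, h3, -, -⟩ := h
  omega

lemma isGreatest_peakCharge {a : ℕ} {w : List Step} {x : ℕ} (hx : x ∈ peakSet w) :
    IsGreatest {c | Admissible a w x c} (peakCharge a w x) := by
  have hb : BddAbove {c | Admissible a w x c} := ⟨height a w x, fun c hc => hc.le_height⟩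
  exact ⟨Nat.sSup_mem ⟨1, admissible_one hx⟩ hb, fun c hc => le_csSup hb hc⟩

/-- The total charge of a word continued by `alpha` moves. -/
noncomputable def wordCharge (a : ℕ) (w : List Step) : ℕ :=
  ∑ x ∈ peakSet w, peakCharge a w x

/-- A projection of abscissas from `w` to `v` under which `w` arises from `v` by inserting
factors `beta alpha`, at least one at each peak of `v`. -/
structure IsProjection (a : ℕ) (w v : List Step) (φ : ℕ → ℕ) : Prop where
  mono : Monotone φ
  height_peak : ∀ t ∈ peakSet w, height a w t = height a v (φ t) + 1
  height_nonpeak : ∀ t, t ∉ peakSet w → height a w t = height a v (φ t)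
  exists_nonpeak : ∀ x, ∃ t, t ∉ peakSet w ∧ φ t = x
  exists_peak : ∀ x ∈ peakSet v, ∃ t ∈ peakSet w, φ t = x

namespace IsProjection

variable {a : ℕ} {w v : List Step} {φ : ℕ → ℕ}

lemma height_le (H : IsProjection a w v φ) (t : ℕ) : height a v (φ t) ≤ height a w t := by
  by_cases ht : t ∈ peakSet w
  · rw [H.height_peak t ht]; omega
  · rw [H.height_nonpeak t ht]

lemma lt_of_lt (H : IsProjection a w v φ) {t t' : ℕ} (h : φ t < φ t') : t < t' := by
  by_contra h'
  exact absurd (H.mono (not_lt.1 h')) (not_le.2 h)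

/-- A charge larger than one occurs only at the first peak over a peak of `v`. -/
lemma admissible_down (H : IsProjection a w v φ) {t c : ℕ} (ht : t ∈ peakSet w)
    (hc : 1 ≤ c) (h : Admissible a w t (c + 1)) :
    φ t ∈ peakSet v ∧ (∀ t' ∈ peakSet w, t' < t → φ t' ≠ φ t) ∧ Admissible a v (φ t) c := by
  obtain ⟨-, x', x'', hx', hx'', h1, h2, h3⟩ := h
  have hy := H.height_peak t ht
  have e1 := H.height_le x'
  have e2 := H.height_le x''
  have l1 : φ x' < φ t := lt_of_le_of_ne (H.mono hx'.le) (by intro h; rw [h] at e1; omega)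
  have l2 : φ t < φ x'' := lt_of_le_of_ne (H.mono hx''.le) (by intro h; rw [← h] at e2; omega)
  have key : ∀ z ∈ peakSet v, φ x' < z → z < φ x'' → z ≠ φ t →
      height a v z ≤ height a v (φ t) ∧ (height a v z = height a v (φ t) → φ t < z) := by
    intro z hz z1 z2 z3
    obtain ⟨u, hu, rfl⟩ := H.exists_peak z hz
    have := h3 u hu (H.lt_of_lt z1) (H.lt_of_lt z2) (by rintro rfl; exact z3 rfl)
    rw [H.height_peak u hu, hy] at this
    exact ⟨by omega, fun e => lt_of_le_of_ne (H.mono (this.2 (by omega)).le) z3.symm⟩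
  refine ⟨?_, ?_, hc, φ x', φ x'', l1, l2, by omega, by omega, key⟩
  -- If `φ t` is not a peak of `v`, the path `v` is higher next to `φ t` on the left or on the
  -- right. As it is lower at `φ x'` and `φ x''`, there is a higher peak in between, against `key`.
  · by_contra hn
    have hpos : φ t ≠ 0 := by omega
    obtain ⟨x, hx⟩ := Nat.exists_eq_succ_of_ne_zero hpos
    simp only [Nat.succ_eq_add_one] at hx
    rw [hx] at hy l1 l2 key hn
    rw [succ_mem_peakSet, not_and_or] at hn
    have hs : stepAt v x = beta := by
      refine (eq_alpha_or_eq_beta _).resolve_left fun h => ?_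
      have := height_succ_of_alpha (a := a) h
      obtain ⟨z, hz, z1, z2, z3⟩ := exists_peak_between (a := a) (w := v) (p := φ x') (u := x)
        (q := x + 1) (by omega) (by omega) (by omega) (by omega)
      have := key z hz z1 (by omega) (by omega)
      omega
    have hs' : stepAt v (x + 1) = beta :=
      (eq_alpha_or_eq_beta _).resolve_left fun h => by simp [h, hs] at hn
    have := height_succ_of_beta (a := a) hs'
    obtain ⟨z, hz, z1, z2, z3⟩ := exists_peak_between (a := a) (w := v) (p := φ x')
      (u := x + 1 + 1) (q := φ x'') (by omega) (by omega) (by omega) (by omega)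
    have := key z hz z1 z2 (by rintro rfl; omega)
    omega
  · intro u hu hut he
    have := h3 u hu (H.lt_of_lt (by omega)) (by omega) (by omega)
    rw [H.height_peak u hu, hy, he] at this
    omega

/-- The two witnesses are lifted to points that are not peaks, where the heights in `w` and `v`
agree, whereas the peak itself gains one; this is the gain from `c` to `c + 1`. -/
lemma admissible_up (H : IsProjection a w v φ) {t c : ℕ} (ht : t ∈ peakSet w)
    (hv : φ t ∈ peakSet v) (hfirst : ∀ t' ∈ peakSet w, t' < t → φ t' ≠ φ t)
    (h : Admissible a v (φ t) c) : Admissible a w t (c + 1) := by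
  obtain ⟨hc, x₁, x₂, l1, l2, h1, h2, h3⟩ := h
  obtain ⟨t₁, ht₁, rfl⟩ := H.exists_nonpeak x₁
  obtain ⟨t₂, ht₂, rfl⟩ := H.exists_nonpeak x₂
  have hy := H.height_peak t ht
  have e1 := H.height_nonpeak t₁ ht₁
  have e2 := H.height_nonpeak t₂ ht₂
  refine ⟨by omega, t₁, t₂, H.lt_of_lt l1, H.lt_of_lt l2, by omega, by omega, ?_⟩
  intro z hz z1 z2 z3
  rw [H.height_peak z hz, hy]
  have m1 := H.mono z1.le
  have m2 := H.mono z2.le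
  have hpk := height_pos_of_mem_peakSet (a := a) hv
  rcases lt_trichotomy (φ z) (φ t) with hlt | heq | hgt
  · suffices height a v (φ z) < height a v (φ t) by omega
    -- The point `φ t - 1` lies one below the peak `φ t`, so a point of height at least that of `φ
    -- t` further left would force a peak of `v` that the admissibility of `c` forbids.
    by_contra hn
    obtain ⟨u, hu, u1, u2, u3⟩ := exists_peak_between (a := a) (w := v) (p := φ t₁) (u := φ z)
      (q := φ t - 1) m1 (by omega) (by omega) (by omega)
    have := h3 u hu u1 (by omega) (by omega)
    omega
  · rw [heq]
    refine ⟨le_rfl, fun _ => ?_⟩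
    by_contra hn
    exact hfirst z hz (by omega) heq
  · refine ⟨?_, fun _ => H.lt_of_lt hgt⟩
    by_contra hn
    obtain ⟨u, hu, u1, u2, u3⟩ := exists_peak_between (a := a) (w := v) (p := φ t) (u := φ z)
      (q := φ t₂) hgt.le m2 (by omega) (by omega)
    have := h3 u hu (by omega) u2 (by omega)
    omega

-- Among the peaks of `w` over one peak of `v` only the leftmost inherits its charge, because in the
-- definition of charge ties are decided in favour of the leftmost peak.
open Classical in
lemma peakCharge_eq (H : IsProjection a w v φ) {t : ℕ} (ht : t ∈ peakSet w) :
    peakCharge a w t = 1 + if φ t ∈ peakSet v ∧ ∀ t' ∈ peakSet w, t' < t → φ t' ≠ φ t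
      then peakCharge a v (φ t) else 0 := by
  refine (isGreatest_peakCharge ht).unique ⟨?_, ?_⟩
  · split_ifs with h
    · rw [add_comm]
      exact H.admissible_up ht h.1 h.2 (isGreatest_peakCharge h.1).1
    · exact admissible_one ht
  · intro c hc
    have h0 := hc.1
    rcases Nat.lt_or_ge c 2 with h2 | h2
    · omega
    · obtain ⟨c, rfl⟩ := Nat.exists_eq_succ_of_ne_zero (by omega : c ≠ 0)
      obtain ⟨i1, i2, i3⟩ := H.admissible_down ht (by omega) hc
      rw [if_pos ⟨i1, i2⟩]
      have := (isGreatest_peakCharge i1).2 i3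
      omega

/-- Each peak of `w` contributes one, and mapping to `v` those peaks that inherit more is a
bijection onto the peaks of `v`. -/
lemma wordCharge_eq (H : IsProjection a w v φ) :
    wordCharge a w = (peakSet w).card + wordCharge a v := by
  classical
  unfold wordCharge
  rw [Finset.sum_congr rfl fun t ht => H.peakCharge_eq ht, Finset.sum_add_distrib,
    Finset.sum_const, smul_eq_mul, mul_one, ← Finset.sum_filter]
  congr 1
  refine Finset.sum_nbij φ ?_ ?_ ?_ (fun _ _ => rfl)
  · intro t ht
    exact (Finset.mem_filter.1 ht).2.1
  · intro t ht t' ht' he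
    simp only [Finset.coe_filter, Set.mem_ofPred_eq] at ht ht'
    rcases lt_trichotomy t t' with h | h | h
    · exact absurd he (ht'.2.2 t ht.1 h)
    · exact h
    · exact absurd he.symm (ht.2.2 t' ht'.1 h)
  · intro x hx
    have hne : ((peakSet w).filter fun t => φ t = x).Nonempty := by
      obtain ⟨t, ht, rfl⟩ := H.exists_peak x hx
      exact ⟨t, by simp [ht]⟩
    obtain ⟨t, ht, hmin⟩ := Finset.exists_min_image _ id hne
    rw [Finset.mem_filter] at ht
    refine ⟨t, ?_, ht.2⟩
    simp only [Finset.coe_filter, Set.mem_ofPred_eq]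
    refine ⟨ht.1, by rw [ht.2]; exact hx, fun t' ht' hlt he => ?_⟩
    have := hmin t' (Finset.mem_filter.2 ⟨ht', by rw [he, ht.2]⟩)
    simp only [id] at this
    omega

end IsProjection

/-! ### Deleting all factors `beta alpha` -/

/-- Prepend a move to a word, up to trailing `alpha` moves. -/
def scons : Step → List Step → List Step
  | alpha, [] => []
  | s, r => s :: r

@[simp] lemma scons_alpha_nil : scons alpha [] = [] := rfl
@[simp] lemma scons_beta (r : List Step) : scons beta r = beta :: r := by cases r <;> rfl
@[simp] lemma scons_cons (s t : Step) (r : List Step) : scons s (t :: r) = s :: t :: r := by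
  cases s <;> rfl

lemma stepAt_scons (s : Step) (r : List Step) : stepAt (scons s r) = stepAt (s :: r) := by
  rcases s with _ | _ <;> rcases r with _ | ⟨t, r⟩ <;> simp
  funext x
  cases x <;> simp

lemma height_congr {a : ℕ} {w v : List Step} (h : stepAt w = stepAt v) :
    height a w = height a v := by
  funext x
  induction x with
  | zero => simp
  | succ x ih => rw [height_succ, height_succ, ih, h]

lemma peakSet_congr {w v : List Step} (h : stepAt w = stepAt v) : peakSet w = peakSet v := by
  ext x
  rw [mem_peakSet, mem_peakSet, h]

@[simp] lemma height_scons (a : ℕ) (s : Step) (r : List Step) :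
    height a (scons s r) = height a (s :: r) := height_congr (stepAt_scons s r)

@[simp] lemma peakSet_scons (s : Step) (r : List Step) :
    peakSet (scons s r) = peakSet (s :: r) := peakSet_congr (stepAt_scons s r)

/-- A word without trailing `alpha` moves. -/
def Canonical (w : List Step) : Prop := w.getLast? ≠ some alpha

@[simp] lemma canonical_nil : Canonical [] := by simp [Canonical]

@[simp] lemma canonical_cons_cons (s t : Step) (r : List Step) :
    Canonical (s :: t :: r) ↔ Canonical (t :: r) := by simp [Canonical]

@[simp] lemma canonical_beta (r : List Step) : Canonical (beta :: r) ↔ Canonical r := by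
  cases r <;> simp [Canonical]

lemma not_canonical_alpha : ¬ Canonical [alpha] := by simp [Canonical]

lemma canonical_scons {s : Step} {r : List Step} (h : Canonical r) : Canonical (scons s r) := by
  rcases s with _ | _ <;> rcases r with _ | ⟨t, r⟩ <;> simp_all

lemma Canonical.tail {s : Step} {r : List Step} (h : Canonical (s :: r)) : Canonical r := by
  rcases r with _ | ⟨t, r⟩ <;> simp_all

lemma Canonical.scons_eq {s : Step} {r : List Step} (h : Canonical (s :: r)) :
    scons s r = s :: r := by
  rcases s with _ | _ <;> rcases r with _ | ⟨t, r⟩ <;> simp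
  exact not_canonical_alpha h

/-- Delete all factors `beta alpha` of a word continued by `alpha` moves. -/
def shrink : List Step → List Step
  | [] => []
  | alpha :: r => scons alpha (shrink r)
  | [beta] => []
  | beta :: alpha :: r => shrink r
  | beta :: beta :: r => beta :: shrink (beta :: r)

/-- The abscissas, in the shrunk word, of the deleted factors `beta alpha`. -/
def bumps : List Step → Multiset ℕ
  | [] => 0
  | alpha :: r => (bumps r).map Nat.succ
  | [beta] => {0}
  | beta :: alpha :: r => 0 ::ₘ bumps r
  | beta :: beta :: r => (bumps (beta :: r)).map Nat.succ

/-- The abscissa in the shrunk word of a point of the word. -/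
def proj : List Step → ℕ → ℕ
  | [], t => t
  | _ :: _, 0 => 0
  | alpha :: r, t + 1 => proj r t + 1
  -- The deleted factor consists of `beta` and the first implicit `alpha`; truncation sends both the
  -- peak at 1 and the point at 2 to 0.
  | [beta], t + 1 => t - 1
  | beta :: alpha :: _, 1 => 0
  | beta :: alpha :: r, t + 2 => proj r t
  | beta :: beta :: r, t + 1 => proj (beta :: r) t + 1

@[simp] lemma proj_zero (w : List Step) : proj w 0 = 0 := by
  cases w <;> simp [proj]

lemma canonical_shrink (w : List Step) : Canonical (shrink w) := by
  fun_induction shrink w with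
  | case1 => simp
  | case2 r ih => exact canonical_scons ih
  | case3 => simp
  | case4 r ih => exact ih
  | case5 r ih => simpa using ih

lemma peakSet_nil : peakSet [] = ∅ := by
  ext x; simp [mem_peakSet]

lemma peakSet_alpha_cons (r : List Step) :
    peakSet (alpha :: r) = (peakSet r).map ⟨Nat.succ, Nat.succ_injective⟩ := by
  ext x
  rcases x with _ | _ | x <;> simp [mem_peakSet]

lemma peakSet_beta_cons {r : List Step} (h : stepAt r 0 = beta) :
    peakSet (beta :: r) = (peakSet r).map ⟨Nat.succ, Nat.succ_injective⟩ := by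
  ext x
  rcases x with _ | _ | x <;> simp [mem_peakSet, h]

lemma peakSet_beta_alpha_cons (r : List Step) :
    peakSet (beta :: alpha :: r) =
      insert 1 ((peakSet r).map ⟨fun x => x + 2, add_left_injective 2⟩) := by
  ext x
  rcases x with _ | _ | _ | x <;> simp [mem_peakSet]

lemma peakSet_beta_singleton : peakSet [beta] = {1} := by decide

lemma card_bumps (w : List Step) : (bumps w).card = (peakSet w).card := by
  fun_induction bumps w with
  | case1 => simp [peakSet_nil]
  | case2 r ih => simp [peakSet_alpha_cons, ih]
  | case3 => simp [peakSet_beta_singleton]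
  | case4 r ih =>
    rw [peakSet_beta_alpha_cons, Finset.card_insert_of_notMem (by simp)]
    simp [ih]
  | case5 r ih => simp [peakSet_beta_cons, ih]

lemma sum_map_succ (s : Multiset ℕ) : (s.map Nat.succ).sum = s.sum + s.card := by
  induction s using Multiset.induction with
  | empty => simp
  | cons a s ih => simp [ih]; omega

/-- The `r`-th deleted factor, with bump `b`, is preceded by `2 * (r - 1)` deleted letters, so its
peak has abscissa `b + 2 * r - 1`; the odd numbers add up to the square. -/
lemma sum_peakSet (w : List Step) :
    ∑ x ∈ peakSet w, x = (bumps w).sum + (peakSet w).card ^ 2 := by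
  fun_induction bumps w with
  | case1 => simp [peakSet_nil]
  | case2 r ih =>
    simp [peakSet_alpha_cons, Finset.sum_add_distrib, ih, card_bumps]; ring
  | case3 => simp [peakSet_beta_singleton]
  | case4 r ih =>
    rw [peakSet_beta_alpha_cons, Finset.card_insert_of_notMem (by simp),
      Finset.sum_insert (by simp)]
    simp [Finset.sum_add_distrib, ih]; ring
  | case5 r ih =>
    simp [peakSet_beta_cons, Finset.sum_add_distrib, ih, card_bumps]; ring

lemma exists_peak_of_mem_bumps {w : List Step} {x : ℕ} (hx : x ∈ bumps w) :
    ∃ t ∈ peakSet w, proj w t = x := by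
  fun_induction bumps w generalizing x with
  | case1 => simp at hx
  | case2 r ih =>
    obtain ⟨y, hy, rfl⟩ := Multiset.mem_map.1 hx
    obtain ⟨t, ht, rfl⟩ := ih hy
    exact ⟨t + 1, by simpa [peakSet_alpha_cons] using ht, rfl⟩
  | case3 =>
    simp only [Multiset.mem_singleton] at hx
    exact ⟨1, by simp [peakSet_beta_singleton], by simp [proj, hx]⟩
  | case4 r ih =>
    rcases Multiset.mem_cons.1 hx with rfl | hx
    · exact ⟨1, by simp, rfl⟩
    · obtain ⟨t, ht, rfl⟩ := ih hx
      exact ⟨t + 2, by simpa [peakSet_beta_alpha_cons] using ht, rfl⟩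
  | case5 r ih =>
    obtain ⟨y, hy, rfl⟩ := Multiset.mem_map.1 hx
    obtain ⟨t, ht, rfl⟩ := ih hy
    exact ⟨t + 1, by simpa [peakSet_beta_cons] using ht, rfl⟩

lemma zero_mem_bumps {w : List Step} :
    0 ∈ bumps w ↔ stepAt w 0 = beta ∧ stepAt w 1 = alpha := by
  fun_cases bumps w <;> simp

lemma stepAt_shrink_zero_of_alpha {w : List Step} (h : stepAt w 0 = alpha) :
    stepAt (shrink w) 0 = alpha := by
  fun_cases shrink w <;> simp_all [stepAt_scons]

lemma shrink_beta_cons {r : List Step} (h : stepAt r 0 = beta) :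
    shrink (beta :: r) = beta :: shrink r := by
  rcases r with _ | ⟨_ | _, r⟩ <;> simp at h; rw [shrink]

lemma bumps_beta_cons {r : List Step} (h : stepAt r 0 = beta) :
    bumps (beta :: r) = (bumps r).map Nat.succ := by
  rcases r with _ | ⟨_ | _, r⟩ <;> simp at h; rw [bumps]

/-- If nothing had been deleted between the `beta` and the `alpha` of a peak of the shrunk word,
they would have been adjacent in `w` and deleted themselves. -/
lemma mem_bumps_of_mem_peakSet_shrink {w : List Step} {x : ℕ} (hx : x ∈ peakSet (shrink w)) :
    x ∈ bumps w := by
  fun_induction shrink w generalizing x with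
  | case1 => simp [peakSet_nil] at hx
  | case2 r ih =>
    simp only [peakSet_scons, peakSet_alpha_cons, Finset.mem_map] at hx
    obtain ⟨x, hx, rfl⟩ := hx
    exact Multiset.mem_map.2 ⟨x, ih hx, rfl⟩
  | case3 => simp [peakSet_nil] at hx
  | case4 r ih => exact Multiset.mem_cons_of_mem (ih hx)
  | case5 r ih =>
    rw [bumps]
    rcases x with _ | _ | x
    · simp at hx
    · refine Multiset.mem_map.2 ⟨0, ?_, rfl⟩
      rcases r with _ | ⟨_ | _, r⟩
      · simp [bumps]
      · simp [bumps]
      · simp [shrink] at hx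
    · exact Multiset.mem_map.2 ⟨x + 1, ih (by simpa using hx), rfl⟩

lemma monotone_proj (w : List Step) : Monotone (proj w) := by
  refine monotone_nat_of_le_succ fun t => ?_
  fun_induction proj w t with
  | case1 t => simp [proj]
  | case2 => simp
  | case3 r t ih => simpa [proj] using ih
  | case4 t => simp [proj]
  | case5 r => simp [proj]
  | case6 r t ih => simpa [proj] using ih
  | case7 r t ih => simpa [proj] using ih

lemma height_eq_proj (a : ℕ) (w : List Step) (t : ℕ) :
    height a w t = height a (shrink w) (proj w t) + if t ∈ peakSet w then 1 else 0 := by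
  fun_induction proj w t generalizing a with
  | case1 t => simp [shrink, peakSet_nil]
  | case2 => simp
  | case3 r t ih => simp [shrink, ih, peakSet_alpha_cons]
  | case4 t => rcases t with _ | t <;> simp [shrink, peakSet_beta_singleton, Step.move]
  | case5 r => simp [Step.move]
  | case6 r t ih => simp [shrink, ih, peakSet_beta_alpha_cons, Step.move]
  | case7 r t ih => simp [shrink, ih, peakSet_beta_cons]

lemma exists_nonpeak_proj (w : List Step) (x : ℕ) : ∃ t, t ∉ peakSet w ∧ proj w t = x := by
  fun_induction shrink w generalizing x with
  | case1 => exact ⟨x, by simp [peakSet_nil], rfl⟩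
  | case2 r ih =>
    rcases x with _ | x
    · exact ⟨0, by simp, rfl⟩
    · obtain ⟨t, ht, rfl⟩ := ih x
      exact ⟨t + 1, by simpa [peakSet_alpha_cons] using ht, rfl⟩
  | case3 => exact ⟨x + 2, by simp [peakSet_beta_singleton], rfl⟩
  | case4 r ih =>
    obtain ⟨t, ht, rfl⟩ := ih x
    exact ⟨t + 2, by simpa [peakSet_beta_alpha_cons] using ht, rfl⟩
  | case5 r ih =>
    rcases x with _ | x
    · exact ⟨0, by simp, rfl⟩
    · obtain ⟨t, ht, rfl⟩ := ih x
      exact ⟨t + 1, by simpa [peakSet_beta_cons] using ht, rfl⟩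

lemma isProjection_shrink (a : ℕ) (w : List Step) : IsProjection a w (shrink w) (proj w) where
  mono := monotone_proj w
  height_peak t ht := by rw [height_eq_proj, if_pos ht]
  height_nonpeak t ht := by rw [height_eq_proj, if_neg ht, add_zero]
  exists_nonpeak := exists_nonpeak_proj w
  exists_peak _ hx := exists_peak_of_mem_bumps (mem_bumps_of_mem_peakSet_shrink hx)

lemma wordCharge_shrink (a : ℕ) (w : List Step) :
    wordCharge a w = (peakSet w).card + wordCharge a (shrink w) :=
  (isProjection_shrink a w).wordCharge_eq

/-! ### A word is determined by its shrunk word and its bumps -/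

lemma shrink_beta_scons_alpha (r : List Step) : shrink (beta :: scons alpha r) = shrink r := by
  cases r <;> simp [shrink]

lemma bumps_beta_scons_alpha (r : List Step) :
    bumps (beta :: scons alpha r) = 0 ::ₘ bumps r := by
  cases r <;> simp [bumps]

lemma shrink_scons_alpha (r : List Step) : shrink (scons alpha r) = scons alpha (shrink r) := by
  cases r <;> simp [shrink]

lemma bumps_scons_alpha (r : List Step) :
    bumps (scons alpha r) = (bumps r).map Nat.succ := by
  cases r <;> simp [bumps]

lemma exists_eq_map_succ {s : Multiset ℕ} (h : 0 ∉ s) : ∃ s' : Multiset ℕ, s = s'.map Nat.succ := by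
  refine ⟨s.map Nat.pred, ?_⟩
  rw [Multiset.map_map]
  conv_lhs => rw [← Multiset.map_id s]
  refine Multiset.map_congr rfl fun x hx => ?_
  have : x ≠ 0 := by rintro rfl; exact h hx
  simp; omega

/-- The word is rebuilt from the left: a bump at 0 gives a factor `beta alpha`; otherwise the first
letter of `v` (an implicit `alpha` if `v` is empty) is copied and all bumps move down by one. Each
step lowers the quantity bounded by `n`. -/
lemma exists_shrink_eq (n : ℕ) (v : List Step) (s : Multiset ℕ)
    (hn : v.length + s.sum + s.card ≤ n) (hv : Canonical v) (hs : ∀ x ∈ peakSet v, x ∈ s) :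
    ∃ w, Canonical w ∧ shrink w = v ∧ bumps w = s := by
  induction n generalizing v s with
  | zero =>
    have h1 : v = [] := List.length_eq_zero_iff.1 (by omega)
    have h2 : s = 0 := Multiset.card_eq_zero.1 (by omega)
    exact ⟨[], by simp, by simp [shrink, h1], by simp [bumps, h2]⟩
  | succ n ih =>
    by_cases h0 : 0 ∈ s
    · obtain ⟨s, rfl⟩ := Multiset.exists_cons_of_mem h0
      simp only [Multiset.sum_cons, Multiset.card_cons] at hn
      obtain ⟨w, hw, rfl, rfl⟩ := ih v s (by omega) hv fun x hx =>
        (Multiset.mem_cons.1 (hs x hx)).resolve_left (by rintro rfl; simp at hx)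
      exact ⟨beta :: scons alpha w, by simpa using canonical_scons hw,
        shrink_beta_scons_alpha w, bumps_beta_scons_alpha w⟩
    · obtain ⟨s, rfl⟩ := exists_eq_map_succ h0
      simp only [sum_map_succ, Multiset.card_map] at hn
      rcases v with _ | ⟨_ | _, v⟩
      · rcases Nat.eq_zero_or_pos s.card with h | h
        · rw [Multiset.card_eq_zero] at h
          exact ⟨[], by simp, by simp [shrink], by simp [bumps, h]⟩
        · obtain ⟨w, hw, h1, rfl⟩ := ih [] s (by simp at hn ⊢; omega) (by simp) (by simp [peakSet_nil])
          exact ⟨scons alpha w, canonical_scons hw, by simp [shrink_scons_alpha, h1],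
            bumps_scons_alpha w⟩
      · obtain ⟨w, hw, h1, rfl⟩ := ih v s (by simp at hn; omega) hv.tail
          (by simpa [peakSet_alpha_cons] using hs)
        exact ⟨scons alpha w, canonical_scons hw,
          by rw [shrink_scons_alpha, h1, hv.scons_eq], bumps_scons_alpha w⟩
      · obtain ⟨w, hw, h1, rfl⟩ := ih v s (by simp at hn; omega) hv.tail fun x hx => by
          have hx0 : x ≠ 0 := by rintro rfl; simp at hx
          obtain ⟨x, rfl⟩ := Nat.exists_eq_succ_of_ne_zero hx0
          simpa using hs (x + 1 + 1) (by simpa using hx)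
        -- Prefixing `beta` must not create a new factor `beta alpha`. If `w` began with `alpha`, so
        -- would its shrunk word, making 1 a peak of `beta :: v`; then 0 would be a bump of `w`,
        -- which needs an initial `beta`.
        have hb : stepAt w 0 = beta := by
          refine (eq_alpha_or_eq_beta _).resolve_left fun h => ?_
          have h2 := stepAt_shrink_zero_of_alpha h
          rw [h1] at h2
          have h3 := hs 1 (by simp [h2])
          obtain ⟨x, hx, hx1⟩ := Multiset.mem_map.1 h3
          obtain rfl : x = 0 := by omega
          simp [zero_mem_bumps, h] at hx
        exact ⟨beta :: w, by simpa using hw, by rw [shrink_beta_cons hb, h1], bumps_beta_cons hb⟩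

lemma eq_nil_of_bumps {w : List Step} (hw : Canonical w) (h : bumps w = 0) : w = [] := by
  fun_induction bumps w with
  | case1 => rfl
  | case2 r ih =>
    have := ih hw.tail (by simpa using h)
    subst this
    exact absurd hw not_canonical_alpha
  | case3 => simp at h
  | case4 r ih => simp at h
  | case5 r ih => exact absurd (ih hw.tail (by simpa using h)) (by simp)

lemma eq_scons_of_canonical {w : List Step} (hw : Canonical w) (hne : w ≠ []) :
    (∃ r, Canonical r ∧ w = beta :: scons alpha r) ∨
      (∃ r, Canonical r ∧ stepAt r 0 = beta ∧ w = beta :: r) ∨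
      ∃ r, Canonical r ∧ r ≠ [] ∧ w = alpha :: r := by
  rcases w with _ | ⟨_ | _, r⟩
  · exact absurd rfl hne
  · refine Or.inr (Or.inr ⟨r, hw.tail, ?_, rfl⟩)
    rintro rfl
    exact not_canonical_alpha hw
  · rcases r with _ | ⟨_ | _, r⟩
    · exact Or.inl ⟨[], by simp, by simp⟩
    · exact Or.inl ⟨r, hw.tail.tail, by rw [hw.tail.scons_eq]⟩
    · exact Or.inr (Or.inl ⟨_, hw.tail, by simp, rfl⟩)

/-- The three shapes of `eq_scons_of_canonical` can be told apart: the first has a bump at 0, and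
the other two differ in the first letter of the shrunk word. -/
lemma eq_of_shrink_eq_of_bumps_eq (n : ℕ) {w w' : List Step} (hn : w.length ≤ n)
    (hw : Canonical w) (hw' : Canonical w')
    (h : shrink w = shrink w') (hb : bumps w = bumps w') : w = w' := by
  induction n generalizing w w' with
  | zero =>
    obtain rfl : w = [] := List.length_eq_zero_iff.1 (by omega)
    exact (eq_nil_of_bumps hw' (by rw [← hb]; rfl)).symm
  | succ n ih =>
    by_cases h1 : w = []
    · subst h1
      exact (eq_nil_of_bumps hw' (by rw [← hb]; rfl)).symm
    by_cases h2 : w' = []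
    · subst h2
      exact eq_nil_of_bumps hw (by rw [hb]; rfl)
    have hinj := Multiset.map_injective Nat.succ_injective
    rcases eq_scons_of_canonical hw h1 with ⟨r, hr, rfl⟩ | ⟨r, hr, hrb, rfl⟩ | ⟨r, hr, hrn, rfl⟩ <;>
    rcases eq_scons_of_canonical hw' h2 with
      ⟨r', hr', rfl⟩ | ⟨r', hr', hrb', rfl⟩ | ⟨r', hr', hrn', rfl⟩
    · rw [shrink_beta_scons_alpha, shrink_beta_scons_alpha] at h
      rw [bumps_beta_scons_alpha, bumps_beta_scons_alpha, Multiset.cons_inj_right] at hb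
      have hl : r.length ≤ n := by
        rcases r with _ | ⟨t, r⟩ <;> simp at hn ⊢; omega
      rw [ih hl hr hr' h hb]
    · rw [bumps_beta_scons_alpha, bumps_beta_cons hrb'] at hb
      have : 0 ∈ (bumps r').map Nat.succ := hb ▸ Multiset.mem_cons_self 0 _
      simp at this
    · rw [bumps_beta_scons_alpha, bumps] at hb
      have : 0 ∈ (bumps r').map Nat.succ := hb ▸ Multiset.mem_cons_self 0 _
      simp at this
    · rw [bumps_beta_scons_alpha, bumps_beta_cons hrb] at hb
      have : 0 ∈ (bumps r).map Nat.succ := hb ▸ Multiset.mem_cons_self 0 _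
      simp at this
    · rw [shrink_beta_cons hrb, shrink_beta_cons hrb'] at h
      rw [bumps_beta_cons hrb, bumps_beta_cons hrb'] at hb
      rw [ih (by simpa using hn) hr hr' (List.cons.inj h).2 (hinj hb)]
    · have := stepAt_shrink_zero_of_alpha (w := alpha :: r') (by simp)
      rw [← h, shrink_beta_cons hrb] at this
      simp at this
    · rw [bumps_beta_scons_alpha, bumps] at hb
      have : 0 ∈ (bumps r).map Nat.succ := hb ▸ Multiset.mem_cons_self 0 _
      simp at this
    · have := stepAt_shrink_zero_of_alpha (w := alpha :: r) (by simp)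
      rw [h, shrink_beta_cons hrb'] at this
      simp at this
    · rw [shrink, shrink] at h
      rw [bumps, bumps] at hb
      have h' : shrink r = shrink r' := by
        rcases e : shrink r with _ | ⟨t, u⟩ <;> rcases e' : shrink r' with _ | ⟨t', u'⟩ <;>
          simp_all
      rw [ih (by simpa using hn) hr hr' h' (hinj hb)]

/-! ### Encoding words by tuples of multisets -/

/-- The words of the paths from `(0, a)` whose peaks have height at most `h`. -/
def boundedWords (h a : ℕ) : Set (List Step) :=
  {w | Canonical w ∧ ∀ x ∈ peakSet w, height a w x ≤ h}

lemma stepAt_of_length_le {w : List Step} {x : ℕ} (h : w.length ≤ x) : stepAt w x = alpha := by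
  simp [stepAt, List.getElem?_eq_none h]

lemma height_length_add (a : ℕ) (w : List Step) (n : ℕ) :
    height a w (w.length + n) = height a w w.length - n := by
  induction n with
  | zero => simp
  | succ n ih =>
    rw [← add_assoc, height_succ_of_alpha (stepAt_of_length_le (by omega)), ih]
    omega

/-- The path starts at height at most `h` and eventually reaches 0, so a point above `h` would force
a peak above `h`. -/
lemma height_le_of_peaks {a h : ℕ} {w : List Step} (ha : a ≤ h)
    (hw : ∀ x ∈ peakSet w, height a w x ≤ h) (x : ℕ) : height a w x ≤ h := by
  by_contra hx
  have h0 : height a w (w.length + (height a w w.length + x)) = 0 := by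
    rw [height_length_add]; omega
  obtain ⟨z, hz, -, -, h1⟩ := exists_peak_between (a := a) (w := w) (p := 0) (u := x)
    (q := w.length + (height a w w.length + x)) (by omega) (by omega) (by simp; omega) (by omega)
  have := hw z hz
  omega

/-- The number of elements of a tuple of multisets. -/
def tupleSize {h : ℕ} (f : Fin h → Multiset ℕ) : ℕ := ∑ j, (f j).card

/-- The weight of the path encoded by a tuple of multisets. -/
def tupleWeight : (h : ℕ) → ℕ → (Fin h → Multiset ℕ) → ℕ
  | 0, _, _ => 0
  | h + 1, a, f => (f 0).sum + tupleSize f ^ 2 + (if a = h + 1 then tupleSize f else 0) +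
      tupleWeight h (min a h) (Fin.tail f)

/-- The total charge of the path encoded by a tuple of multisets. -/
def tupleCharge : (h : ℕ) → (Fin h → Multiset ℕ) → ℕ
  | 0, _ => 0
  | h + 1, f => tupleSize f + tupleCharge h (Fin.tail f)

/-- `Φ` encodes the words of the paths from `(0, a)` with peaks of height at most `h`. -/
structure IsEncoding (h a : ℕ) (Φ : List Step → Fin h → Multiset ℕ) : Prop where
  bijOn : Set.BijOn Φ (boundedWords h a) Set.univ
  card_peakSet : ∀ w ∈ boundedWords h a, (peakSet w).card = tupleSize (Φ w)
  sum_peakSet : ∀ w ∈ boundedWords h a, ∑ x ∈ peakSet w, x = tupleWeight h a (Φ w)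
  wordCharge : ∀ w ∈ boundedWords h a, wordCharge a w = tupleCharge h (Φ w)

lemma eq_nil_of_mem_boundedWords_zero {w : List Step} (hw : w ∈ boundedWords 0 0) : w = [] := by
  refine eq_nil_of_bumps hw.1 ?_
  rw [← Multiset.card_eq_zero, card_bumps, Finset.card_eq_zero, Finset.eq_empty_iff_forall_notMem]
  intro x hx
  have h1 := hw.2 x hx
  have h2 := height_pos_of_mem_peakSet (a := 0) hx
  omega

lemma isEncoding_zero (Φ : List Step → Fin 0 → Multiset ℕ) : IsEncoding 0 0 Φ where
  bijOn := by
    refine ⟨fun _ _ => Set.mem_univ _, fun w hw w' hw' _ => ?_, fun f _ => ?_⟩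
    · rw [eq_nil_of_mem_boundedWords_zero hw, eq_nil_of_mem_boundedWords_zero hw']
    · exact ⟨[], ⟨by simp, by simp [peakSet_nil]⟩, Subsingleton.elim _ _⟩
  card_peakSet w hw := by
    simp [eq_nil_of_mem_boundedWords_zero hw, peakSet_nil, tupleSize]
  sum_peakSet w hw := by
    simp [eq_nil_of_mem_boundedWords_zero hw, peakSet_nil, tupleWeight]
  wordCharge w hw := by
    simp [eq_nil_of_mem_boundedWords_zero hw, peakSet_nil, LatticePath.wordCharge, tupleCharge]

lemma shrink_mem_boundedWords {h a : ℕ} {w : List Step} (ha : a ≤ h) (hw : Canonical w) :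
    shrink w ∈ boundedWords h a ↔ w ∈ boundedWords (h + 1) a := by
  have H := isProjection_shrink a w
  constructor
  · rintro ⟨-, h1⟩
    refine ⟨hw, fun x hx => ?_⟩
    rw [H.height_peak x hx]
    have := height_le_of_peaks ha h1 (proj w x)
    omega
  · rintro ⟨-, h1⟩
    refine ⟨canonical_shrink w, fun x hx => ?_⟩
    obtain ⟨t, ht, rfl⟩ := H.exists_peak x hx
    have h2 := h1 t ht
    rw [H.height_peak t ht] at h2
    omega

lemma peakSet_shrink_le_bumps (w : List Step) : (peakSet (shrink w)).val ≤ bumps w :=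
  (Multiset.le_iff_subset (peakSet (shrink w)).nodup).2 fun _ hx =>
    mem_bumps_of_mem_peakSet_shrink hx

lemma tupleSize_cons {h : ℕ} (s : Multiset ℕ) (f : Fin h → Multiset ℕ) :
    tupleSize (Fin.cons s f : Fin (h + 1) → Multiset ℕ) = s.card + tupleSize f := by
  simp [tupleSize, Fin.sum_univ_succ]

/-- The new entry is the surplus of the bumps over the forced ones. The forced bumps sum to the
weight of the shrunk word, which makes the weight recursive. -/
lemma IsEncoding.succ {h a : ℕ} (ha : a ≤ h) {Φ : List Step → Fin h → Multiset ℕ}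
    (H : IsEncoding h a Φ) :
    IsEncoding (h + 1) a
      fun w => Fin.cons (bumps w - (peakSet (shrink w)).val) (Φ (shrink w)) := by
  have hsub (w : List Step) :
      bumps w - (peakSet (shrink w)).val + (peakSet (shrink w)).val = bumps w :=
    tsub_add_cancel_of_le (peakSet_shrink_le_bumps w)
  have hmem {w : List Step} (hw : w ∈ boundedWords (h + 1) a) : shrink w ∈ boundedWords h a :=
    (shrink_mem_boundedWords ha hw.1).2 hw
  have hcard {w : List Step} (hw : w ∈ boundedWords (h + 1) a) :
      (peakSet w).card = tupleSize (Fin.cons (bumps w - (peakSet (shrink w)).val)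
        (Φ (shrink w)) : Fin (h + 1) → Multiset ℕ) := by
    rw [tupleSize_cons, ← H.card_peakSet _ (hmem hw), ← card_bumps w]
    conv_lhs => rw [← hsub w]
    simp
  refine ⟨⟨fun _ _ => Set.mem_univ _, fun w hw w' hw' he => ?_, fun f _ => ?_⟩,
    fun w hw => hcard hw, fun w hw => ?_, fun w hw => ?_⟩
  · obtain ⟨h1, h2⟩ := Fin.cons_injective2 he
    have h3 := H.bijOn.injOn (hmem hw) (hmem hw') h2
    refine eq_of_shrink_eq_of_bumps_eq _ le_rfl hw.1 hw'.1 h3 ?_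
    rw [← hsub w, ← hsub w', h1, h3]
  · obtain ⟨v, hv, hvf⟩ := H.bijOn.surjOn (Set.mem_univ (Fin.tail f))
    obtain ⟨w, hw, rfl, hb⟩ := exists_shrink_eq _ v (f 0 + (peakSet v).val) le_rfl hv.1
      fun x hx => Multiset.mem_add.2 (Or.inr hx)
    refine ⟨w, (shrink_mem_boundedWords ha hw).1 hv, ?_⟩
    simp only [hb, hvf, add_tsub_cancel_right]
    exact Fin.cons_self_tail f
  · have h1 := H.sum_peakSet _ (hmem hw)
    have h2 : (bumps w).sum = (bumps w - (peakSet (shrink w)).val).sum +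
        ∑ x ∈ peakSet (shrink w), x := by
      conv_lhs => rw [← hsub w]
      simp
    rw [LatticePath.sum_peakSet, h2, h1, hcard hw, tupleWeight, if_neg (by omega), min_eq_left ha,
      Fin.tail_cons, Fin.cons_zero]
    ring
  · rw [wordCharge_shrink, hcard hw, H.wordCharge _ (hmem hw), tupleCharge, Fin.tail_cons]

lemma wordCharge_congr {a : ℕ} {w v : List Step} (h : stepAt w = stepAt v) :
    wordCharge a w = wordCharge a v := by
  unfold wordCharge peakCharge Admissible
  rw [peakSet_congr h, height_congr h]

lemma admissible_alpha_cons {h : ℕ} {r : List Step} {x c : ℕ} (hx : height h r x ≤ h + 1) :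
    Admissible (h + 1) (alpha :: r) (x + 1) c ↔ Admissible h r x c := by
  have hh (t : ℕ) : height (h + 1) (alpha :: r) (t + 1) = height h r t := rfl
  have hp (t : ℕ) : t + 1 ∈ peakSet (alpha :: r) ↔ t ∈ peakSet r := by
    simp [peakSet_alpha_cons]
  constructor
  · rintro ⟨hc, x', x'', h1, h2, h3, h4, h5⟩
    rw [hh] at h3 h4
    rcases x' with _ | x'
    -- The added starting point has height `h + 1`, at least that of the peak, so it cannot witness
    -- a positive charge.
    · rw [height_zero] at h3
      omega
    rcases x'' with _ | x''
    · omega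
    rw [hh] at h3 h4
    refine ⟨hc, x', x'', by omega, by omega, h3, h4, fun z hz z1 z2 z3 => ?_⟩
    have := h5 (z + 1) ((hp z).2 hz) (by omega) (by omega) (by omega)
    rw [hh, hh] at this
    omega
  · rintro ⟨hc, x', x'', h1, h2, h3, h4, h5⟩
    refine ⟨hc, x' + 1, x'' + 1, by omega, by omega, h3, h4, fun z hz z1 z2 z3 => ?_⟩
    obtain ⟨z, rfl⟩ := Nat.exists_eq_succ_of_ne_zero (by omega : z ≠ 0)
    have := h5 z ((hp z).1 hz) (by omega) (by omega) (by omega)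
    rw [Nat.succ_eq_add_one, hh, hh]
    omega

lemma wordCharge_alpha_cons {h : ℕ} {r : List Step}
    (hr : ∀ x ∈ peakSet r, height h r x ≤ h + 1) :
    wordCharge (h + 1) (alpha :: r) = wordCharge h r := by
  unfold wordCharge
  rw [peakSet_alpha_cons, Finset.sum_map]
  refine Finset.sum_congr rfl fun x hx => ?_
  simp only [Function.Embedding.coeFn_mk, Nat.succ_eq_add_one, peakCharge,
    admissible_alpha_cons (hr x hx)]

lemma eq_scons_tail_of_mem_boundedWords {h : ℕ} {w : List Step}
    (hw : w ∈ boundedWords (h + 1) (h + 1)) : w = scons alpha w.tail := by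
  rcases w with _ | ⟨_ | _, r⟩
  · rfl
  · exact hw.1.scons_eq.symm
  · have := height_le_of_peaks le_rfl hw.2 1
    simp [Step.move] at this

lemma scons_mem_boundedWords {h : ℕ} {r : List Step} (hr : Canonical r) :
    scons alpha r ∈ boundedWords (h + 1) (h + 1) ↔ r ∈ boundedWords (h + 1) h := by
  simp [boundedWords, canonical_scons hr, hr, peakSet_alpha_cons, Step.move]

/-- From height `h + 1` a first move `beta` would exceed the bound. Removing the initial `alpha`
shifts every peak by one, which is the summand of `tupleWeight` for `a = h + 1`. -/
lemma IsEncoding.tail {h : ℕ} {Φ : List Step → Fin (h + 1) → Multiset ℕ}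
    (H : IsEncoding (h + 1) h Φ) : IsEncoding (h + 1) (h + 1) fun w => Φ w.tail := by
  have hcan {w : List Step} (hw : w ∈ boundedWords (h + 1) (h + 1)) : Canonical w.tail := by
    rcases w with _ | ⟨s, r⟩
    · simp
    · exact hw.1.tail
  have hmem {w : List Step} (hw : w ∈ boundedWords (h + 1) (h + 1)) :
      w.tail ∈ boundedWords (h + 1) h := by
    rw [← scons_mem_boundedWords (hcan hw), ← eq_scons_tail_of_mem_boundedWords hw]
    exact hw
  have hpk {w : List Step} (hw : w ∈ boundedWords (h + 1) (h + 1)) :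
      peakSet w = (peakSet w.tail).map ⟨Nat.succ, Nat.succ_injective⟩ := by
    conv_lhs => rw [eq_scons_tail_of_mem_boundedWords hw, peakSet_scons, peakSet_alpha_cons]
  refine ⟨⟨fun _ _ => Set.mem_univ _, fun w hw w' hw' he => ?_, fun f _ => ?_⟩,
    fun w hw => ?_, fun w hw => ?_, fun w hw => ?_⟩
  · rw [eq_scons_tail_of_mem_boundedWords hw, eq_scons_tail_of_mem_boundedWords hw',
      H.bijOn.injOn (hmem hw) (hmem hw') he]
  · obtain ⟨r, hr, hrf⟩ := H.bijOn.surjOn (Set.mem_univ f)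
    refine ⟨scons alpha r, (scons_mem_boundedWords hr.1).2 hr, ?_⟩
    have : (scons alpha r).tail = r := by cases r <;> simp
    simp only [this, hrf]
  · rw [hpk hw, Finset.card_map, H.card_peakSet _ (hmem hw)]
  · rw [hpk hw, Finset.sum_map]
    simp only [Function.Embedding.coeFn_mk, Nat.succ_eq_add_one, Finset.sum_add_distrib,
      Finset.sum_const, smul_eq_mul, mul_one]
    rw [H.sum_peakSet _ (hmem hw), H.card_peakSet _ (hmem hw)]
    simp [tupleWeight]
    ring
  · rw [← H.wordCharge _ (hmem hw)]
    conv_lhs => rw [eq_scons_tail_of_mem_boundedWords hw]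
    rw [wordCharge_congr (stepAt_scons _ _), wordCharge_alpha_cons (hmem hw).2]

theorem exists_isEncoding {h a : ℕ} (ha : a ≤ h) : ∃ Φ, IsEncoding h a Φ := by
  induction h generalizing a with
  | zero =>
    obtain rfl : a = 0 := by omega
    exact ⟨fun _ _ => 0, isEncoding_zero _⟩
  | succ h ih =>
    rcases Nat.lt_or_ge h a with hlt | hle
    · obtain rfl : a = h + 1 := by omega
      obtain ⟨Φ, H⟩ := ih (le_refl h)
      exact ⟨_, (H.succ le_rfl).tail⟩
    · obtain ⟨Φ, H⟩ := ih hle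
      exact ⟨_, H.succ hle⟩

/-! ### Restricted paths -/

/-- The word `w` prolonged to a path from `(0, a)` that ends when it reaches the axis. -/
def completion (a : ℕ) (w : List Step) : List Step :=
  w ++ List.replicate (height a w w.length) alpha

lemma stepAt_append_replicate (w : List Step) (n : ℕ) :
    stepAt (w ++ List.replicate n alpha) = stepAt w := by
  funext x
  unfold stepAt
  rw [List.getElem?_append]
  split_ifs with h
  · rfl
  · rw [List.getElem?_eq_none (not_lt.1 h), List.getElem?_replicate]
    split_ifs <;> rfl

lemma pathHeight_eq_height (a : ℕ) (w : List Step) {x : ℕ} (hx : x ≤ w.length) :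
    pathHeight a w x = height a w x := by
  induction w generalizing a x with
  | nil => simp at hx; simp [pathHeight, hx]
  | cons s r ih =>
    rcases x with _ | x
    · simp [pathHeight]
    · rw [height_cons_succ, ← ih _ (by simpa using hx)]
      simp [pathHeight]

lemma pathHeight_append_replicate (a : ℕ) (w : List Step) {n x : ℕ} (hx : x ≤ w.length + n) :
    pathHeight a (w ++ List.replicate n alpha) x = height a w x := by
  rw [pathHeight_eq_height _ _ (by simpa using hx), height_congr (stepAt_append_replicate w n)]

/-- With fewer final `alpha` moves the path misses the axis; with more, its last move is horizontal.
-/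
lemma isRestrictedPath_append_replicate {a h n : ℕ} {w : List Step}
    (H : IsRestrictedPath a h (w ++ List.replicate n alpha)) : n = height a w w.length := by
  have h1 := H.ends_on_axis
  rw [pathHeight_append_replicate _ _ (by simp), List.length_append, List.length_replicate,
    height_length_add] at h1
  by_contra hne
  obtain ⟨n, rfl⟩ := Nat.exists_eq_succ_of_ne_zero (by omega : n ≠ 0)
  refine H.last_not_horizontal (w.length + n) (by simp; omega) ?_
  rw [pathHeight_append_replicate _ _ (by omega), height_length_add]
  omega

lemma exists_canonical_append (u : List Step) :
    ∃ w n, Canonical w ∧ u = w ++ List.replicate n alpha := by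
  induction u using List.reverseRecOn with
  | nil => exact ⟨[], 0, by simp, rfl⟩
  | append_singleton u s ih =>
    rcases s with _ | _
    · obtain ⟨w, n, hw, rfl⟩ := ih
      exact ⟨w, n + 1, hw, by simp [List.replicate_succ']⟩
    · exact ⟨u ++ [beta], 0, by simp [Canonical], by simp⟩

lemma canonical_append_replicate_inj {w w' : List Step} {n n' : ℕ} (hw : Canonical w)
    (hw' : Canonical w') (h : w ++ List.replicate n alpha = w' ++ List.replicate n' alpha) :
    w = w' := by
  induction n generalizing n' with
  | zero =>
    rcases n' with _ | n'
    · simpa using h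
    · rw [List.replicate_succ', ← List.append_assoc] at h
      simp only [List.replicate_zero, List.append_nil] at h
      rw [h] at hw
      simp [Canonical] at hw
  | succ n ih =>
    rcases n' with _ | n'
    · rw [List.replicate_succ', ← List.append_assoc] at h
      simp only [List.replicate_zero, List.append_nil] at h
      rw [← h] at hw'
      simp [Canonical] at hw'
    · rw [List.replicate_succ', List.replicate_succ', ← List.append_assoc,
        ← List.append_assoc] at h
      exact ih (List.append_cancel_right h)

lemma length_completion (a : ℕ) (w : List Step) :
    (completion a w).length = w.length + height a w w.length := by simp [completion]

lemma pathHeight_completion (a : ℕ) (w : List Step) {x : ℕ} (hx : x ≤ (completion a w).length) :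
    pathHeight a (completion a w) x = height a w x :=
  pathHeight_append_replicate a w (by simpa [completion] using hx)

lemma height_length_completion (a : ℕ) (w : List Step) :
    height a w (completion a w).length = 0 := by
  rw [length_completion, height_length_add, Nat.sub_self]

lemma lt_length_completion {a : ℕ} {w : List Step} {x : ℕ} (hx : x ∈ peakSet w) :
    x < (completion a w).length := by
  obtain ⟨h1, h2, -⟩ := mem_peakSet.1 hx
  have h3 : x - 1 < w.length := by
    by_contra h
    rw [stepAt_of_length_le (not_lt.1 h)] at h2
    cases h2
  by_contra h
  rw [length_completion] at h
  obtain rfl : x = w.length := by omega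
  have := height_pos_of_mem_peakSet (a := a) hx
  omega

lemma peaks_subset_peakSet (w : List Step) : peaks w ⊆ peakSet w := by
  intro x hx
  obtain ⟨-, h1, h2, h3⟩ := Finset.mem_filter.1 hx
  exact mem_peakSet.2 ⟨h1, by simp [stepAt, h2], by simp [stepAt, h3]⟩

lemma getElem?_eq_stepAt {w : List Step} {x : ℕ} (hx : x < w.length) :
    w[x]? = some (stepAt w x) := by
  simp [stepAt, List.getElem?_eq_getElem hx]

lemma peaks_completion (a : ℕ) (w : List Step) : peaks (completion a w) = peakSet w := by
  have hs : stepAt (completion a w) = stepAt w := stepAt_append_replicate _ _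
  refine Finset.Subset.antisymm ?_ fun x hx => ?_
  · rw [← peakSet_congr hs]
    exact peaks_subset_peakSet _
  · have h0 := lt_length_completion (a := a) hx
    obtain ⟨h1, h2, h3⟩ := mem_peakSet.1 hx
    refine Finset.mem_filter.2 ⟨Finset.mem_range.2 h0, h1, ?_, ?_⟩
    · rw [getElem?_eq_stepAt (by omega), hs, h2]
    · rw [getElem?_eq_stepAt h0, hs, h3]

/-- Heights change by at most one per move, so points that are low enough can be moved towards the
peak until they have exactly the required height; a smaller interval contains fewer peaks. -/
lemma chargeAdmissible_completion {a : ℕ} {w : List Step} {x c : ℕ} (hx : x ∈ peakSet w)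
    (hc : 1 ≤ c) : ChargeAdmissible a (completion a w) x c ↔ Admissible a w x c := by
  have hlt := lt_length_completion (a := a) hx
  have hpk : ∀ z ∈ peakSet w, pathHeight a (completion a w) z = height a w z := fun z hz =>
    pathHeight_completion a w (lt_length_completion hz).le
  constructor
  · rintro ⟨x', x'', h1, h2, h3, h4, h5, h6⟩
    rw [hpk x hx, pathHeight_completion a w (by omega)] at h4 h5
    refine ⟨hc, x', x'', h1, h2, h4.le, h5.le, fun z hz z1 z2 z3 => ?_⟩
    have := h6 z (by rwa [peaks_completion]) z1 z2 z3
    rwa [hpk x hx, hpk z hz] at this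
  · rintro ⟨-, x', x'', h1, h2, h4, h5, h6⟩
    obtain ⟨y', l1, l2, l3⟩ := exists_height_eq_of_le (a := a) (w := w) (p := x') (q := x)
      (m := height a w x - c) h1.le (by omega) (by omega)
    have hend := height_length_completion a w
    -- The right witness may lie beyond the end of the finite path; the end, at height 0, then
    -- replaces it.
    obtain ⟨y'', r1, r2, r3⟩ := exists_height_eq_of_ge (a := a) (w := w) (p := x)
      (q := min x'' (completion a w).length) (m := height a w x - c) (by omega) (by omega)
      (by rcases min_choice x'' (completion a w).length with h | h <;> rw [h] <;> omega)
    have n1 : y' ≠ x := by rintro rfl; omega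
    have n2 : y'' ≠ x := by rintro rfl; omega
    refine ⟨y', y'', by omega, by omega, by omega, ?_, ?_, ?_⟩
    · rw [hpk x hx, pathHeight_completion a w (by omega)]; omega
    · rw [hpk x hx, pathHeight_completion a w (by omega)]; omega
    · intro z hz z1 z2 z3
      rw [peaks_completion] at hz
      rw [hpk x hx, hpk z hz]
      exact h6 z hz (by omega) (by omega) z3

lemma charge_completion {a : ℕ} {w : List Step} {x : ℕ} (hx : x ∈ peakSet w) :
    charge a (completion a w) x = peakCharge a w x := by
  have h := isGreatest_peakCharge (a := a) hx
  have h1 := h.1.1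
  refine IsGreatest.csSup_eq ⟨(chargeAdmissible_completion hx h1).2 h.1, fun c hc => ?_⟩
  rcases Nat.eq_zero_or_pos c with rfl | hpos
  · omega
  · exact h.2 ((chargeAdmissible_completion hx hpos).1 hc)

lemma totalCharge_completion (a : ℕ) (w : List Step) :
    totalCharge a (completion a w) = wordCharge a w := by
  unfold totalCharge wordCharge
  rw [peaks_completion]
  exact Finset.sum_congr rfl fun x hx => charge_completion hx

lemma isRestrictedPath_completion {a h : ℕ} {w : List Step} (hw : Canonical w) :
    IsRestrictedPath a h (completion a w) ↔ w ∈ boundedWords h a := by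
  have hpk : ∀ z ∈ peakSet w, pathHeight a (completion a w) z = height a w z := fun z hz =>
    pathHeight_completion a w (lt_length_completion hz).le
  constructor
  · intro H
    refine ⟨hw, fun x hx => ?_⟩
    rw [← hpk x hx]
    exact H.peak_le x (by rwa [peaks_completion])
  · rintro ⟨-, H⟩
    refine ⟨?_, fun t ht h0 => ?_, fun x hx => ?_⟩
    · rw [pathHeight_completion a w le_rfl, height_length_completion]
    · rw [pathHeight_completion a w (by omega)] at h0
      rw [length_completion] at ht
      rcases Nat.eq_zero_or_pos (height a w w.length) with h1 | h1
      · rw [h1, add_zero] at ht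
        rcases w.eq_nil_or_concat' with rfl | ⟨u, s, rfl⟩
        · simp at ht
        · rcases s with _ | _
          · simp [Canonical] at hw
          · rw [← ht, height_succ_of_beta] at h1
            · omega
            · have : t = u.length := by simpa using ht
              simp [stepAt, this]
      · obtain ⟨n, hn⟩ := Nat.exists_eq_succ_of_ne_zero h1.ne'
        obtain rfl : t = w.length + n := by omega
        rw [height_length_add] at h0
        omega
    · rw [peaks_completion] at hx
      rw [hpk x hx]
      exact H x hx

lemma bijOn_completion (a h n m : ℕ) :
    Set.BijOn (completion a)
      {w ∈ boundedWords h a | ∑ x ∈ peakSet w, x = n ∧ wordCharge a w = m}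
      {w | IsRestrictedPath a h w ∧ pathWeight w = n ∧ totalCharge a w = m} := by
  refine ⟨?_, fun w hw w' hw' he => canonical_append_replicate_inj hw.1.1 hw'.1.1 he, ?_⟩
  · rintro w ⟨h1, h2⟩
    refine ⟨(isRestrictedPath_completion h1.1).2 h1, ?_⟩
    rwa [totalCharge_completion, pathWeight, peaks_completion]
  · rintro u ⟨h1, h2⟩
    obtain ⟨w, l, hw, rfl⟩ := exists_canonical_append u
    obtain rfl := isRestrictedPath_append_replicate h1
    change _ ∧ totalCharge a (completion a w) = m at h2
    change pathWeight (completion a w) = n ∧ _ at h2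
    rw [totalCharge_completion, pathWeight, peaks_completion] at h2
    exact ⟨w, ⟨(isRestrictedPath_completion hw).1 h1, h2⟩, rfl⟩

/-! ### Multiple partitions -/

/-- Add to a list the smallest sequence with last term `b` and differences `g`. -/
def spread (g b : ℕ) : List ℕ → List ℕ
  | [] => []
  | x :: r => (x + b + g * r.length) :: spread g b r

@[simp] lemma length_spread (g b : ℕ) (l : List ℕ) : (spread g b l).length = l.length := by
  induction l with
  | nil => rfl
  | cons x r ih => simp [spread, ih]

lemma spread_injective (g b : ℕ) : Function.Injective (spread g b) := by
  intro l
  induction l with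
  | nil =>
    intro l' h
    exact (List.length_eq_zero_iff.1 (by rw [← length_spread g b, ← h]; rfl)).symm
  | cons x r ih =>
    rintro (_ | ⟨y, r'⟩) h
    · simp [spread] at h
    · simp only [spread, List.cons.injEq] at h
      obtain rfl := ih h.2
      simpa using h.1

/-- With gaps `2 * d`, a last term `d` makes the added terms odd multiples of `d`, whence the
square. -/
lemma sum_spread (d b : ℕ) (l : List ℕ) :
    (spread (2 * d) (d + b) l).sum = l.sum + b * l.length + d * l.length ^ 2 := by
  induction l with
  | nil => simp [spread]
  | cons x r ih => simp only [spread, List.sum_cons, ih, List.length_cons]; ring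

lemma isChain_spread {g b : ℕ} {l : List ℕ} (hl : l.IsChain (· ≥ ·)) :
    (spread g b l).IsChain (fun x y => x ≥ y + g) := by
  induction l with
  | nil => simp [spread]
  | cons x r ih =>
    rcases r with _ | ⟨y, r⟩
    · simp [spread]
    · rw [List.isChain_cons_cons] at hl
      have h1 := ih hl.2
      simp only [spread] at h1 ⊢
      refine List.isChain_cons_cons.2 ⟨?_, h1⟩
      have := hl.1
      simp only [List.length_cons, mul_add, mul_one]
      omega

lemma le_getLast_spread {g b : ℕ} {l : List ℕ} : ∀ x ∈ (spread g b l).getLast?, b ≤ x := by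
  induction l with
  | nil => simp [spread]
  | cons x r ih =>
    rcases r with _ | ⟨y, r⟩
    · simp [spread]
    · simp only [spread, List.getLast?_cons_cons] at ih ⊢
      exact ih

lemma exists_spread_eq {g b : ℕ} {p : List ℕ} (hp : p.IsChain (fun x y => x ≥ y + g))
    (hlast : ∀ x ∈ p.getLast?, b ≤ x) : ∃ l : List ℕ, l.IsChain (· ≥ ·) ∧ spread g b l = p := by
  induction p with
  | nil => exact ⟨[], by simp, rfl⟩
  | cons x r ih =>
    rcases r with _ | ⟨y, r⟩
    · have : b ≤ x := hlast x (by simp)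
      exact ⟨[x - b], by simp, by simp [spread]; omega⟩
    · rw [List.isChain_cons_cons] at hp
      rw [List.getLast?_cons_cons] at hlast
      obtain ⟨l, h1, h2⟩ := ih hp.2 hlast
      rcases l with _ | ⟨z, l⟩
      · simp [spread] at h2
      · have h3 := hp.1
        have h4 := (List.cons.inj h2).1
        refine ⟨(x - b - g * (l.length + 1)) :: z :: l, List.isChain_cons_cons.2 ⟨?_, h1⟩, ?_⟩
        · rw [mul_add]; omega
        · rw [spread, h2, List.length_cons]
          congr 1
          rw [mul_add]; omega

/-- The multiple partition encoded by a tuple of multisets. -/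
def toPartition (i : ℕ) {h : ℕ} (f : Fin h → Multiset ℕ) (j : Fin h) : List ℕ :=
  spread (2 * (j.val + 1))
    (j.val + 1 + ((j.val + 2 - i) + 2 * (j.val + 1) * ∑ l ∈ Finset.Ioi j, (f l).card))
    ((f j).sort (· ≥ ·))

lemma length_toPartition (i : ℕ) {h : ℕ} (f : Fin h → Multiset ℕ) (j : Fin h) :
    (toPartition i f j).length = (f j).card := by simp [toPartition]

lemma sum_toPartition (i : ℕ) {h : ℕ} (f : Fin h → Multiset ℕ) (j : Fin h) :
    (toPartition i f j).sum = (f j).sum + (f j).card * (j.val + 2 - i) +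
      (j.val + 1) * ((f j).card ^ 2 + 2 * (f j).card * ∑ l ∈ Finset.Ioi j, (f l).card) := by
  have hs : ((f j).sort (· ≥ ·)).sum = (f j).sum := by
    rw [← Multiset.sum_coe, Multiset.sort_eq]
  rw [toPartition, sum_spread, hs, Multiset.length_sort]
  ring

lemma toPartition_injective (i h : ℕ) :
    Function.Injective (toPartition i : (Fin h → Multiset ℕ) → _) := by
  intro f f' he
  -- The shift in each component depends on the other cardinalities, so these are recovered from the
  -- lengths beforehand.
  have hc (j : Fin h) : (f j).card = (f' j).card := by
    rw [← length_toPartition i f, he, length_toPartition]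
  funext j
  have h1 := congrFun he j
  simp only [toPartition, hc] at h1
  rw [← Multiset.sort_eq (f j) (· ≥ ·), spread_injective _ _ h1, Multiset.sort_eq]

lemma smallest_bound_eq (i j M : ℕ) :
    ((j + 1 : ℕ) : ℤ) + max (((j + 1 : ℕ) : ℤ) - (i : ℤ) + 1) 0 + 2 * ((j + 1 : ℕ) : ℤ) * (M : ℤ) =
      ((j + 1 + ((j + 2 - i) + 2 * (j + 1) * M) : ℕ) : ℤ) := by
  have : max (((j + 1 : ℕ) : ℤ) - (i : ℤ) + 1) 0 = ((j + 2 - i : ℕ) : ℤ) := by omega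
  rw [this]
  push_cast
  ring

lemma isMultiplePartition_toPartition (k i : ℕ) (f : Fin (k - 1) → Multiset ℕ) :
    IsMultiplePartition k i (toPartition i f) where
  gap j := isChain_spread ((Multiset.pairwise_sort (f j) (· ≥ ·)).isChain)
  smallest j x hx := by
    simp only [length_toPartition]
    rw [smallest_bound_eq, ge_iff_le, Nat.cast_le]
    exact le_getLast_spread x hx

lemma exists_toPartition_eq {k i : ℕ} {p : Fin (k - 1) → List ℕ}
    (hp : IsMultiplePartition k i p) : ∃ f, toPartition i f = p := by
  have key (j : Fin (k - 1)) : ∃ l : List ℕ, l.IsChain (· ≥ ·) ∧ spread (2 * (j.val + 1))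
      (j.val + 1 + ((j.val + 2 - i) + 2 * (j.val + 1) * ∑ l ∈ Finset.Ioi j, (p l).length)) l
        = p j := by
    refine exists_spread_eq (hp.gap j) fun x hx => ?_
    have := hp.smallest j x hx
    rwa [smallest_bound_eq, ge_iff_le, Nat.cast_le] at this
  choose l hl hlp using key
  have hlen (j : Fin (k - 1)) : (l j).length = (p j).length := by rw [← hlp j, length_spread]
  refine ⟨fun j => (l j : Multiset ℕ), funext fun j => ?_⟩
  have hsort : (l j : Multiset ℕ).sort (· ≥ ·) = l j := by
    refine List.Perm.eq_of_pairwise' (r := (· ≥ ·)) (Multiset.pairwise_sort _ _)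
      (List.isChain_iff_pairwise.1 (hl j)) ?_
    rw [← Multiset.coe_eq_coe, Multiset.sort_eq]
  simp only [toPartition, hsort, Multiset.coe_card, hlen]
  exact hlp j

lemma tupleSize_sq {h : ℕ} (f : Fin h → Multiset ℕ) :
    tupleSize f ^ 2 =
      ∑ j, ((f j).card ^ 2 + 2 * (f j).card * ∑ l ∈ Finset.Ioi j, (f l).card) := by
  induction h with
  | zero => simp [tupleSize]
  | succ h ih =>
    have := ih (fun j => f j.succ)
    rw [Fin.sum_univ_succ]
    simp only [Fin.sum_Ioi_succ, Fin.sum_Ioi_zero, ← this]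
    simp only [tupleSize, Fin.sum_univ_succ]
    ring

/-- The entry `f j` is counted in the peak numbers of the levels `0, …, j`, hence the factor `j +
1`. An initial `alpha` is removed at the levels `j'` with `h - j' ≤ a`; truncated subtraction counts
those up to `j` as `j + 1 + a - h`. -/
lemma tupleWeight_eq {h a : ℕ} (ha : a ≤ h) (f : Fin h → Multiset ℕ) :
    tupleWeight h a f = ∑ j : Fin h, ((f j).sum + (f j).card * (j.val + 1 + a - h) +
      (j.val + 1) * ((f j).card ^ 2 + 2 * (f j).card * ∑ l ∈ Finset.Ioi j, (f l).card)) := by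
  induction h generalizing a with
  | zero => simp [tupleWeight]
  | succ h ih =>
    rw [tupleWeight, tupleSize_sq, ih (min_le_right a h), Fin.sum_univ_succ, Fin.sum_univ_succ]
    simp only [Fin.sum_Ioi_succ, Fin.sum_Ioi_zero, Fin.tail, Fin.val_zero, Fin.val_succ]
    rcases Nat.lt_or_ge h a with hlt | hle
    · obtain rfl : a = h + 1 := by omega
      have e1 (j : ℕ) : j + 1 + min (h + 1) h - h = j + 1 := by omega
      have e2 (j : ℕ) : j + 1 + 1 + (h + 1) - (h + 1) = j + 1 + 1 := by omega
      have e3 : 0 + 1 + (h + 1) - (h + 1) = 1 := by omega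
      simp only [if_true, e1, e2, e3, tupleSize, Fin.sum_univ_succ, add_mul, mul_add,
        Finset.sum_add_distrib, mul_one, one_mul]
      ring
    · have e1 (j : ℕ) : j + 1 + min a h - h = j + 1 + a - h := by omega
      have e2 (j : ℕ) : j + 1 + 1 + a - (h + 1) = j + 1 + a - h := by omega
      have e3 : 0 + 1 + a - (h + 1) = 0 := by omega
      rw [if_neg (by omega)]
      simp only [e1, e2, e3, add_mul, Finset.sum_add_distrib, one_mul]
      ring

lemma tupleCharge_eq {h : ℕ} (f : Fin h → Multiset ℕ) :
    tupleCharge h f = ∑ j : Fin h, (j.val + 1) * (f j).card := by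
  induction h with
  | zero => simp [tupleCharge]
  | succ h ih =>
    rw [tupleCharge, ih, tupleSize, Fin.sum_univ_succ, Fin.sum_univ_succ]
    simp only [Fin.tail, Fin.val_zero, Fin.val_succ, add_mul, one_mul, Finset.sum_add_distrib]
    ring

lemma bijOn_toPartition {k i : ℕ} (n m : ℕ) (hi : 1 ≤ i) (hik : i ≤ k) :
    Set.BijOn (toPartition i)
      {f | tupleWeight (k - 1) (k - i) f = n ∧ tupleCharge (k - 1) f = m}
      (multiplePartitions k i n m) := by
  have hw (f : Fin (k - 1) → Multiset ℕ) :
      ∑ j, (toPartition i f j).sum = tupleWeight (k - 1) (k - i) f := by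
    rw [tupleWeight_eq (by omega)]
    refine Finset.sum_congr rfl fun j _ => ?_
    rw [sum_toPartition, show j.val + 1 + (k - i) - (k - 1) = j.val + 2 - i by omega]
  have hc (f : Fin (k - 1) → Multiset ℕ) :
      ∑ j, (j.val + 1) * (toPartition i f j).length = tupleCharge (k - 1) f := by
    simp only [tupleCharge_eq, length_toPartition]
  refine ⟨fun f hf => ⟨isMultiplePartition_toPartition k i f, ?_⟩,
    (toPartition_injective i (k - 1)).injOn, ?_⟩
  · rw [hw, hc]
    exact hf
  · rintro p ⟨h1, h2⟩
    obtain ⟨f, rfl⟩ := exists_toPartition_eq h1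
    rw [hw, hc] at h2
    exact ⟨f, h2, rfl⟩

/-- The weight bounds the elements of each multiset by `n` and the charge bounds its cardinality by
`m`, so it is contained in `m` copies of `{0, …, n}`. -/
lemma finite_tuples {h a : ℕ} (ha : a ≤ h) (n m : ℕ) :
    {f : Fin h → Multiset ℕ | tupleWeight h a f = n ∧ tupleCharge h f = m}.Finite := by
  refine (Set.Finite.pi' fun _ : Fin h =>
    Set.finite_Iic (m • (Multiset.range (n + 1)))).subset ?_
  rintro f ⟨h1, h2⟩ j
  rw [tupleWeight_eq ha] at h1
  rw [tupleCharge_eq] at h2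
  have hsum : (f j).sum ≤ n := by
    rw [← h1]
    refine le_trans ?_ (Finset.single_le_sum (fun _ _ => Nat.zero_le _) (Finset.mem_univ j))
    omega
  have hcard : (f j).card ≤ m := by
    rw [← h2]
    refine le_trans ?_ (Finset.single_le_sum (fun _ _ => Nat.zero_le _) (Finset.mem_univ j))
    exact Nat.le_mul_of_pos_left _ (Nat.succ_pos _)
  refine Set.mem_Iic.2 (Multiset.le_iff_count.2 fun x => ?_)
  rw [Multiset.count_nsmul]
  by_cases hx : x ∈ f j
  · have hxn : x ∈ Multiset.range (n + 1) :=
      Multiset.mem_range.2 (Nat.lt_succ_of_le ((Multiset.le_sum_of_mem hx).trans hsum))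
    calc (f j).count x ≤ m * 1 := by
          rw [mul_one]; exact (Multiset.count_le_card x _).trans hcard
      _ ≤ _ := Nat.mul_le_mul_left m (Multiset.one_le_count_iff_mem.2 hxn)
  · rw [Multiset.count_eq_zero_of_notMem hx]
    exact Nat.zero_le _

lemma bijOn_encoding {h a : ℕ} {Φ : List Step → Fin h → Multiset ℕ} (H : IsEncoding h a Φ)
    (n m : ℕ) :
    Set.BijOn Φ {w ∈ boundedWords h a | ∑ x ∈ peakSet w, x = n ∧ wordCharge a w = m}
      {f | tupleWeight h a f = n ∧ tupleCharge h f = m} := by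
  refine ⟨fun w hw => ?_, H.bijOn.injOn.mono fun w hw => hw.1, fun f hf => ?_⟩
  · refine ⟨?_, ?_⟩
    · rw [← H.sum_peakSet w hw.1, hw.2.1]
    · rw [← H.wordCharge w hw.1, hw.2.2]
  · obtain ⟨w, hw, rfl⟩ := H.bijOn.surjOn (Set.mem_univ f)
    exact ⟨w, ⟨hw, by rw [H.sum_peakSet w hw, hf.1], by rw [H.wordCharge w hw, hf.2]⟩, rfl⟩

end LatticePath

open LatticePath in
theorem proposition3 (k i n m : ℕ) (hi : 1 ≤ i) (hik : i ≤ k) :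
    (restrictedPaths k i n m).Finite ∧ (multiplePartitions k i n m).Finite ∧
      numPaths k i n m = numMultiplePartitions k i n m := by
  have ha : k - i ≤ k - 1 := by omega
  obtain ⟨Φ, H⟩ := exists_isEncoding ha
  have b1 := bijOn_completion (k - i) (k - 1) n m
  have b2 := bijOn_encoding H n m
  have b3 := bijOn_toPartition n m hi hik
  have hfin := finite_tuples ha n m
  refine ⟨b1.finite_iff_finite.1 (b2.finite_iff_finite.2 hfin), b3.finite_iff_finite.1 hfin, ?_⟩
  exact b1.ncard_eq.symm.trans (b2.ncard_eq.trans b3.ncard_eq)
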